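/- A weighted digraph $G=(V,E,w)$ consists of a finite set $V$, a set $E\subseteq V\times V$ containing no pair $(i,i)$, and a function $w:E\to(0,\infty)$. Let $d(i,j)\in[0,\infty]$ be the minimal total weight of a directed path from $i$ to $j$ in $G$ ($\infty$ if there is none), and let $G^t$ be the digraph on $V$ with edges $\{(i,j): i\neq j,\ d(i,j)\le t\}$. For a digraph $H$, let $\Omega_\bullet(H)$ be its regular path complex over $\mathbb R$. The grounded persistent path homology $\mathcal H_1(G)$ is the persistent real vector space that is zero for $t<0$ and, for $t\ge 0$, is $$\mathcal H_1(G)(t)=\frac{\ker\big(\partial_1:\Omega_1(G\cup G^t)\to\Omega_0(G\cup G^t)\big)}{\partial_2\big(\Omega_2(G^t)\big)},$$ with the maps induced by inclusions. Its barcode $\mathrm{Bar}(G)$ is the multiset of non-empty real intervals $I$ (unique) such that $\mathcal H_1(G)$ is isomorphic to the direct sum of the corresponding interval modules, and $d_B\in[0,\infty]$ is the bottleneck distance ($\ell^\infty$ matching of interval end points, points of the diagonal being added to both diagrams). For $e\in E$, let $G\setminus e$ be $G$ with the edge $e$ deleted, and let the neighbourhood graph $N(e;G)$ be the weighted subgraph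 of $G$ whose edges are all edges of $G$ sharing a vertex with $e$ (including $e$) and whose vertices are the vertices incident to these edges. **Theorem.** There is no function $f$ from weighted digraphs to $\mathbb R$ such that for every weighted digraph $G=(V,E,w)$ and every edge $e\in E$ $$d_B\big(\mathrm{Bar}(G),\mathrm{Bar}(G\setminus e)\big)\le f\big(N(e;G)\big).$$ Moreover, for $W\ge 1$ let $G_W$ be the weighted digraph on $\{v_0,v_1,v_2,v_3\}$ with edges $(v_0,v_1)$, $(v_1,v_3)$, $(v_2,v_3)$ of weight $1$ and an edge $(v_0,v_2)$ of weight $W$, and let $e=(v_1,v_3)$. Then $N(e;G_W)$ does not depend on $W$, the unique barcode of $\mathcal H_1(G_W)$ is $\{[0,W)\}$, the unique barcode of $\mathcal H_1(G_W\setminus e)$ is empty, and $d_B(\mathrm{Bar}(G_W),\mathrm{Bar}(G_W\setminus e))=W/2$. -/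

import Mathlib

noncomputable section

namespace GrPPH

/-! ### Weighted digraphs -/

/-- A finite simple weighted digraph: no self-loops, and a positive weight on every edge. The weight
function is defined on the edges only. -/
structure WDgr where
  V : Type
  [finite : Finite V]
  E : Set (V × V)
  loopless : ∀ i, (i, i) ∉ E
  w : E → ℝ
  w_pos : ∀ e, 0 < w e

/-- Directed walks (alternating sequences of vertices and forward edges). -/
inductive WDgr.Walk (G : WDgr) : G.V → G.V → Type
  | nil (i : G.V) : WDgr.Walk G i i
  | cons {i j k : G.V} (e : (i, j) ∈ G.E) (p : WDgr.Walk G j k) : WDgr.Walk G i k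

/-- The total weight of the edges of a walk. -/
def WDgr.Walk.length {G : WDgr} : {i j : G.V} → G.Walk i j → ℝ
  | _, _, .nil _ => 0
  | _, _, .cons e p => G.w ⟨_, e⟩ + p.length

/-- The vertices of a walk, in order. -/
def WDgr.Walk.support {G : WDgr} : {i j : G.V} → G.Walk i j → List G.V
  | _, _, .nil i => [i]
  | i, _, .cons _ p => i :: p.support

/-- A path is a walk that repeats no vertex. -/
def WDgr.Walk.IsPath {G : WDgr} {i j : G.V} (p : G.Walk i j) : Prop := p.support.Nodup

/-- The shortest-path quasimetric, with value `⊤` when there is no path. -/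
def WDgr.dist (G : WDgr) (i j : G.V) : EReal :=
  ⨅ (p : G.Walk i j) (_ : p.IsPath), ((p.length : ℝ) : EReal)

/-- The edges `E^t` of the digraph `G^t` of the shortest-path filtration. -/
def WDgr.filtEdges (G : WDgr) (t : ℝ) : Set (G.V × G.V) :=
  {τ | τ.1 ≠ τ.2 ∧ G.dist τ.1 τ.2 ≤ (t : EReal)}

/-- The edges of `G ∪ G^t`. The filtration starts at time `0`: nothing is present before. -/
def WDgr.groundedEdges (G : WDgr) (t : ℝ) : Set (G.V × G.V) :=
  {τ | 0 ≤ t ∧ (τ ∈ G.E ∨ τ ∈ G.filtEdges t)}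

/-- Deletion of the edge `e`. -/
def WDgr.deleteEdge (G : WDgr) (e : G.V × G.V) : WDgr where
  V := G.V
  finite := G.finite
  E := G.E \ {e}
  loopless i h := G.loopless i h.1
  w τ := G.w ⟨τ.1, τ.2.1⟩
  w_pos _ := G.w_pos _

/-- The subgraph induced on a set `E'` of edges: its vertices are those incident to an edge of `E'`,
its edges are exactly the elements of `E'`. -/
def WDgr.inducedOnEdges (G : WDgr) (E' : Set (G.V × G.V)) (h : E' ⊆ G.E) : WDgr where
  V := {v : G.V // ∃ τ ∈ E', v = τ.1 ∨ v = τ.2}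
  finite := by
    have := G.finite
    infer_instance
  E := {τ | (τ.1.1, τ.2.1) ∈ E'}
  loopless i hi := G.loopless i.1 (h hi)
  w τ := G.w ⟨(τ.1.1.1, τ.1.2.1), h τ.2⟩
  w_pos _ := G.w_pos _

/-- The edges having a vertex in common with some edge in `F`. -/
def WDgr.nbhd (G : WDgr) (F : Set (G.V × G.V)) : Set (G.V × G.V) :=
  {τ | τ ∈ G.E ∧ ∃ e ∈ F, ∃ v : G.V, (v = τ.1 ∨ v = τ.2) ∧ (v = e.1 ∨ v = e.2)}

/-- The neighbourhood graph of a set of edges. -/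
def WDgr.nbhdGraph (G : WDgr) (F : Set (G.V × G.V)) : WDgr :=
  G.inducedOnEdges (G.nbhd F) fun _ h => h.1

/-! ### Regular path chains -/

section Chains

variable {V : Type}

/-- A vertex sequence is regular if consecutive vertices differ. -/
def IsRegular {p : ℕ} (x : Fin (p + 1) → V) : Prop := ∀ i : Fin p, x i.castSucc ≠ x i.succ

/-- A vertex sequence is allowed in the digraph with edge set `E` if all its steps are edges. -/
def IsAllowed (E : Set (V × V)) {p : ℕ} (x : Fin (p + 1) → V) : Prop :=
  ∀ i : Fin p, (x i.castSucc, x i.succ) ∈ E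

/-- The real vector space freely generated by all elementary `p`-paths. -/
abbrev Chains (V : Type) (p : ℕ) : Type := (Fin (p + 1) → V) →₀ ℝ

/-- The span of the allowed `p`-paths. -/
def allowedChains (E : Set (V × V)) (p : ℕ) : Submodule ℝ (Chains V p) :=
  Finsupp.supported ℝ ℝ {x | IsAllowed E x}

/-- The non-regular boundary: the alternating sum of the faces. -/
def nregBoundary (V : Type) (p : ℕ) : Chains V (p + 1) →ₗ[ℝ] Chains V p :=
  Finsupp.linearCombination ℝ fun x =>
    ∑ i : Fin (p + 2), Finsupp.single (fun j => x (i.succAbove j)) ((-1 : ℝ) ^ (i : ℕ))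

open Classical in
/-- The projection onto the span of the regular paths. -/
def regProj (V : Type) (p : ℕ) : Chains V p →ₗ[ℝ] Chains V p :=
  Finsupp.linearCombination ℝ fun x => if IsRegular x then Finsupp.single x 1 else 0

/-- The regular boundary. -/
def boundary (V : Type) (p : ℕ) : Chains V (p + 1) →ₗ[ℝ] Chains V p :=
  regProj V p ∘ₗ nregBoundary V p

/-- The `∂`-invariant `(p + 1)`-paths `Ω_{p+1}` of the digraph with edge set `E`. -/
def omegaSucc (E : Set (V × V)) (p : ℕ) : Submodule ℝ (Chains V (p + 1)) :=
  allowedChains E (p + 1) ⊓ (allowedChains E p).comap (boundary V p)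

lemma allowedChains_mono {E E' : Set (V × V)} (h : E ⊆ E') (p : ℕ) :
    allowedChains E p ≤ allowedChains E' p :=
  Finsupp.supported_mono fun _ hx i => h (hx i)

lemma omegaSucc_mono {E E' : Set (V × V)} (h : E ⊆ E') (p : ℕ) :
    omegaSucc E p ≤ omegaSucc E' p :=
  inf_le_inf (allowedChains_mono h _) (Submodule.comap_mono (allowedChains_mono h _))

end Chains

/-! ### Grounded persistent path homology in degree one -/

/-- A persistent vector space: a functor from the poset of real numbers to real vector spaces. -/
abbrev PersVec : Type 1 := CategoryTheory.Functor ℝ (ModuleCat.{0} ℝ)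

lemma WDgr.filtEdges_mono (G : WDgr) {s t : ℝ} (h : s ≤ t) : G.filtEdges s ⊆ G.filtEdges t :=
  fun _ hτ => ⟨hτ.1, hτ.2.trans (EReal.coe_le_coe_iff.2 h)⟩

lemma WDgr.groundedEdges_mono (G : WDgr) {s t : ℝ} (h : s ≤ t) :
    G.groundedEdges s ⊆ G.groundedEdges t :=
  fun _ hτ => ⟨hτ.1.trans h, hτ.2.imp id fun h' => G.filtEdges_mono h h'⟩

/-- Grounded `1`-cycles: the kernel of `∂₁` on `Ω₁(G ∪ G^t)`. -/
def WDgr.cycles (G : WDgr) (t : ℝ) : Submodule ℝ (Chains G.V 1) :=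
  omegaSucc (G.groundedEdges t) 0 ⊓ LinearMap.ker (boundary G.V 0)

/-- Grounded `1`-boundaries: the image of `Ω₂(G^t)` under `∂₂`. -/
def WDgr.boundaries (G : WDgr) (t : ℝ) : Submodule ℝ (Chains G.V 1) :=
  (omegaSucc (G.filtEdges t) 1).map (boundary G.V 1)

lemma WDgr.cycles_mono (G : WDgr) {s t : ℝ} (h : s ≤ t) : G.cycles s ≤ G.cycles t :=
  inf_le_inf_right _ (omegaSucc_mono (G.groundedEdges_mono h) 0)

lemma WDgr.boundaries_mono (G : WDgr) {s t : ℝ} (h : s ≤ t) : G.boundaries s ≤ G.boundaries t :=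
  Submodule.map_mono (omegaSucc_mono (G.filtEdges_mono h) 1)

lemma WDgr.Walk.length_nonneg {G : WDgr} {i j : G.V} (p : G.Walk i j) : 0 ≤ p.length := by
  induction p with
  | nil => simp [WDgr.Walk.length]
  | cons e p ih =>
    have := G.w_pos ⟨_, e⟩
    simp only [WDgr.Walk.length]; linarith

lemma WDgr.nonneg_of_mem_filtEdges {G : WDgr} {t : ℝ} {τ} (h : τ ∈ G.filtEdges t) : 0 ≤ t := by
  have h1 : (0 : EReal) ≤ G.dist τ.1 τ.2 :=
    le_iInf fun p => le_iInf fun _ => by exact_mod_cast p.length_nonneg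
  exact_mod_cast h1.trans h.2

lemma regProj_single {V : Type} {p : ℕ} (x : Fin (p + 1) → V) (a : ℝ) (h : IsRegular x) :
    regProj V p (Finsupp.single x a) = Finsupp.single x a := by
  simp [regProj, Finsupp.linearCombination_single, h]

lemma regProj_single_of_not {V : Type} {p : ℕ} (x : Fin (p + 1) → V) (a : ℝ) (h : ¬ IsRegular x) :
    regProj V p (Finsupp.single x a) = 0 := by
  simp [regProj, Finsupp.linearCombination_single, h]

lemma boundary_edge {V : Type} (a b : V) (r : ℝ) :
    boundary V 0 (Finsupp.single ![a, b] r) = Finsupp.single ![b] r - Finsupp.single ![a] r := by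
  have h : nregBoundary V 0 (Finsupp.single ![a, b] r) =
      Finsupp.single ![b] r - Finsupp.single ![a] r := by
    rw [nregBoundary, Finsupp.linearCombination_single]
    have a0 : (fun j : Fin 1 => ![a, b] ((0 : Fin 2).succAbove j)) = ![b] := by
      funext j; fin_cases j; rfl
    have a1 : (fun j : Fin 1 => ![a, b] ((1 : Fin 2).succAbove j)) = ![a] := by
      funext j; fin_cases j; rfl
    refine (congrArg _ (Fin.sum_univ_two _)).trans ?_
    rw [a0, a1]
    simp [sub_eq_add_neg]
  rw [boundary, LinearMap.comp_apply, h, map_sub, regProj_single _ _ fun i => i.elim0,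
    regProj_single _ _ fun i => i.elim0]

lemma boundary_boundary_single {V : Type} (a b c : V) (hab : a ≠ b) (hbc : b ≠ c) :
    boundary V 0 (boundary V 1 (Finsupp.single ![a, b, c] 1)) = 0 := by
  have h : nregBoundary V 1 (Finsupp.single ![a, b, c] 1) =
      Finsupp.single ![b, c] 1 + Finsupp.single ![a, c] (-1) + Finsupp.single ![a, b] 1 := by
    rw [nregBoundary, Finsupp.linearCombination_single]
    have a0 : (fun j : Fin 2 => ![a, b, c] ((0 : Fin 3).succAbove j)) = ![b, c] := by
      funext j; fin_cases j <;> rfl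
    have a1 : (fun j : Fin 2 => ![a, b, c] ((1 : Fin 3).succAbove j)) = ![a, c] := by
      funext j; fin_cases j <;> rfl
    have a2 : (fun j : Fin 2 => ![a, b, c] ((2 : Fin 3).succAbove j)) = ![a, b] := by
      funext j; fin_cases j <;> rfl
    refine (congrArg _ (Fin.sum_univ_three _)).trans ?_
    rw [a0, a1, a2]
    simp
  have reg : ∀ x y : V, x ≠ y → IsRegular (p := 1) ![x, y] := fun x y hxy i => by
    fin_cases i; exact hxy
  change boundary V 0 (regProj V 1 (nregBoundary V 1 _)) = 0
  rw [h, map_add (regProj _ _), map_add (regProj _ _), regProj_single _ _ (reg _ _ hab),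
    regProj_single _ _ (reg _ _ hbc)]
  by_cases hac : a = c
  · subst hac
    rw [regProj_single_of_not _ _ fun h => h 0 rfl]
    simp [boundary_edge]
  · rw [regProj_single _ _ (reg _ _ hac)]
    simp only [map_add, boundary_edge]
    simp only [Finsupp.single_neg]
    abel

/-- Boundaries are cycles. -/
lemma WDgr.boundaries_le_cycles (G : WDgr) (t : ℝ) : G.boundaries t ≤ G.cycles t := by
  rintro _ ⟨c, hc, rfl⟩
  have hE : G.filtEdges t ⊆ G.groundedEdges t :=
    fun τ hτ => ⟨nonneg_of_mem_filtEdges hτ, .inr hτ⟩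
  refine ⟨⟨allowedChains_mono hE 1 hc.2,
    (Finsupp.mem_supported ℝ _).2 fun x _ i => i.elim0⟩, ?_⟩
  have hc1 : c ∈ Submodule.span ℝ ((fun x => Finsupp.single x (1 : ℝ)) ''
      {x : Fin 3 → G.V | IsAllowed (G.filtEdges t) x}) :=
    (Finsupp.supported_eq_span_single ℝ _).le hc.1
  refine (Submodule.span_le.2 ?_ : _ ≤ LinearMap.ker (boundary G.V 0 ∘ₗ boundary G.V 1)) hc1
  rintro _ ⟨x, hx, rfl⟩
  have hx' : x = ![x 0, x 1, x 2] := by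
    funext j; fin_cases j <;> rfl
  have h := boundary_boundary_single (x 0) (x 1) (x 2) (hx 0).1 (hx 1).1
  rw [← hx'] at h
  exact h

/-- The first grounded homology at time `t`: cycles modulo boundaries, realized as the space of
classes of cycles in the quotient of all `1`-chains by the boundaries (which are cycles). -/
def WDgr.homology (G : WDgr) (t : ℝ) : Submodule ℝ (Chains G.V 1 ⧸ G.boundaries t) :=
  (G.cycles t).map (G.boundaries t).mkQ

/-- The map on homology induced by the inclusion of the stage `s` into the stage `t`. -/
def WDgr.homologyMap (G : WDgr) {s t : ℝ} (h : s ≤ t) : G.homology s →ₗ[ℝ] G.homology t :=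
  ((G.boundaries s).mapQ (G.boundaries t) LinearMap.id (G.boundaries_mono h)).restrict (by
    rintro _ ⟨z, hz, rfl⟩
    exact ⟨z, G.cycles_mono h hz, rfl⟩)

/-- Grounded persistent path homology of a weighted digraph. -/
def WDgr.persHomology (G : WDgr) : PersVec where
  obj t := ModuleCat.of ℝ (G.homology t)
  map h := ModuleCat.ofHom (G.homologyMap h.le)
  map_id t := by
    apply ModuleCat.hom_ext
    ext ⟨_, z, hz, rfl⟩
    rfl
  map_comp f g := by
    apply ModuleCat.hom_ext
    ext ⟨_, z, hz, rfl⟩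
    rfl

/-! ### Interval modules and barcodes -/

/-- Non-empty intervals of the real line (of any kind, bounded or not). -/
def RealInterval : Type := {I : Set ℝ // I.OrdConnected ∧ I.Nonempty}

/-- The vector space `P(I)(t)`, which is `ℝ` if `t ∈ I` and `0` otherwise. -/
def intervalSpace (I : RealInterval) (t : ℝ) : Submodule ℝ ℝ where
  carrier := {x | t ∉ I.1 → x = 0}
  add_mem' ha hb h := by rw [ha h, hb h, add_zero]
  zero_mem' _ := rfl
  smul_mem' c x hx h := by rw [hx h, smul_zero]

open Classical in
/-- The map `P(I)(s ≤ t)`: the identity if `s` and `t` lie in `I`, and zero otherwise. -/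
def intervalMap (I : RealInterval) (s t : ℝ) : intervalSpace I s →ₗ[ℝ] intervalSpace I t :=
  if h : s ∈ I.1 ∧ t ∈ I.1 then
    (intervalSpace I s).subtype.codRestrict (intervalSpace I t) fun _ ht => absurd h.2 ht
  else 0

/-- The direct sum of a finite family of interval modules, formed pointwise. -/
def intervalSum {ι : Type} [Fintype ι] (I : ι → RealInterval) : PersVec where
  obj t := ModuleCat.of ℝ (∀ k, intervalSpace (I k) t)
  map {s t} _ := ModuleCat.ofHom (LinearMap.pi fun k => intervalMap (I k) s t ∘ₗ LinearMap.proj k)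
  map_id t := by
    apply ModuleCat.hom_ext
    ext x k
    by_cases h : t ∈ (I k).1
    · simp [intervalMap, h]
      rfl
    · simp [intervalMap, h, (x k).2 h]
  map_comp {s u t} f g := by
    apply ModuleCat.hom_ext
    ext x k
    by_cases hs : s ∈ (I k).1
    · by_cases ht : t ∈ (I k).1
      · have hu : u ∈ (I k).1 := (I k).2.1.out hs ht ⟨f.le, g.le⟩
        simp [intervalMap, hs, hu, ht]
        rfl
      · simp [intervalMap, ht]
    · simp [intervalMap, hs]

/-- A barcode with finitely many bars. -/
abbrev Barcode : Type := Multiset RealInterval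

open Classical in
/-- `B` is a barcode of `M`: the module `M` is isomorphic to the direct sum of the interval modules
of the elements of `B`, taken with multiplicity. -/
def IsBarcode (M : PersVec) (B : Barcode) : Prop :=
  Nonempty (M ≅ intervalSum fun k : B => k.1)

instance : Inhabited Barcode := ⟨0⟩

/-- The barcode of `M`: the multiset of intervals, unique when it exists, with `IsBarcode M B`. -/
def barcode (M : PersVec) : Barcode := Classical.epsilon (IsBarcode M)

/-- The barcode of the grounded persistent path homology of `G`. -/
def WDgr.barcode (G : WDgr) : Barcode := GrPPH.barcode G.persHomology

/-! ### Bottleneck distance -/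

/-- The pair of end points of an interval, possibly infinite. -/
def RealInterval.endpoints (I : RealInterval) : EReal × EReal :=
  (sInf ((fun x : ℝ => (x : EReal)) '' I.1), sSup ((fun x : ℝ => (x : EReal)) '' I.1))

open Classical in
/-- The distance `|x - y|` of extended reals; equal infinities have distance `0`. -/
def eDist (x y : EReal) : ENNReal := if x = y then 0 else (x - y).abs

/-- The supremum norm of `x - y` for points of the extended plane. -/
def pointDist (x y : EReal × EReal) : ENNReal := max (eDist x.1 y.1) (eDist x.2 y.2)

open Classical in
/-- The points of the diagram of `B` (with multiplicity) together with those of the diagonal. -/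
def diagramPoint (B : Barcode) : B ⊕ ℝ → EReal × EReal :=
  Sum.elim (fun k => k.1.endpoints) fun x => ((x : EReal), (x : EReal))

open Classical in
/-- The bottleneck distance of two barcodes. -/
def bottleneckDist (B₁ B₂ : Barcode) : ENNReal :=
  ⨅ γ : (B₁ ⊕ ℝ) ≃ (B₂ ⊕ ℝ), ⨆ x, pointDist (diagramPoint B₁ x) (diagramPoint B₂ (γ x))

/-! ### The explicit family -/

/-- The bar `[a, b)`. -/
def icoBar (a b : ℝ) (h : a < b) : RealInterval :=
  ⟨Set.Ico a b, Set.ordConnected_Ico, Set.nonempty_Ico.2 h⟩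

/-- The digraph on `v₀, v₁, v₂, v₃` with edges `v₀v₁`, `v₁v₃`, `v₂v₃` of weight `1` and an edge
`v₀v₂` of weight `W`. -/
def square (W : ℝ) (hW : 0 < W) : WDgr where
  V := Fin 4
  E := {(0, 1), (1, 3), (0, 2), (2, 3)}
  loopless i := by
    fin_cases i <;> simp
  w e := if e.1 = (0, 2) then W else 1
  w_pos e := by
    split_ifs
    · exact hW
    · exact one_pos

/-- The edge `v₁v₃` of `square W hW`. -/
def squareEdge (W : ℝ) (hW : 0 < W) : (square W hW).V × (square W hW).V :=
  ((1 : Fin 4), (3 : Fin 4))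

end GrPPH

end

/-! Every edge of the square starts at `v₀` or ends at `v₃`, so the same holds in each digraph of
the shortest-path filtration. In such a digraph Kirchhoff's law at a middle vertex `m` equates the
coefficients of `v₀m` and `mv₃`, hence the cone from `v₀` fills every cycle supported on `G^t`: a
grounded cycle is a boundary exactly when all its edges have appeared in `G^t`. Potentials that grow
by at most the weight along each edge bound the distances from below and so decide which edges have
appeared. The loop around the square is therefore born at `0` and dies at `W`, when its last edge
`v₀v₂` appears. Once `v₁v₃` is deleted, the only cycle compares `v₀v₂v₃` with the shortcut `v₀v₃`
and is born at `W + 1`, when it is already filled.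

A barcode is determined by the ranks of the structure maps `M s → M t`, which count the bars that
contain both `s` and `t`: a bar that is maximal for inclusion among those in which two barcodes
differ contains a pair `s, t` that no bar on the other side contains. The bar `[0, W)` is matched to
its nearest diagonal point, and the diagonal, which has a single point over each real number,
absorbs it by a shift. -/

noncomputable section

namespace GrPPH

section IntervalModules

open CategoryTheory Module

variable {M : PersVec} {B B' : Barcode} {I J : RealInterval} {s t : ℝ}

/-- The linear map from the ground field to the stage `t` of the interval module of `I`: the
identity if `t ∈ I` and zero otherwise. -/
def intervalProj (I : RealInterval) (t : ℝ) : ℝ →ₗ[ℝ] intervalSpace I t :=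
  open Classical in
  if h : t ∈ I.1 then LinearMap.id.codRestrict (intervalSpace I t) fun _ ht => absurd h ht else 0

lemma intervalProj_apply_of_mem (ht : t ∈ I.1) (x : ℝ) : (intervalProj I t x : ℝ) = x := by
  simp only [intervalProj, dif_pos ht]
  rfl

lemma intervalSpace_subsingleton (ht : t ∉ I.1) : Subsingleton (intervalSpace I t) :=
  ⟨fun x y => Subtype.ext ((x.2 ht).trans (y.2 ht).symm)⟩

lemma intervalProj_eq_zero_iff {x : ℝ} : intervalProj I t x = 0 ↔ (t ∈ I.1 → x = 0) := by
  by_cases ht : t ∈ I.1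
  · rw [Subtype.ext_iff, intervalProj_apply_of_mem ht]
    exact ⟨fun h _ => h, fun h => h ht⟩
  · exact iff_of_true ((intervalSpace_subsingleton ht).elim _ _) fun h => absurd h ht

lemma intervalMap_eq_intervalProj_comp (I : RealInterval) (s t : ℝ) :
    intervalMap I s t = intervalProj I t ∘ₗ (intervalSpace I s).subtype := by
  refine LinearMap.ext fun x => ?_
  by_cases hs : s ∈ I.1
  · by_cases ht : t ∈ I.1
    · simp only [intervalMap, intervalProj, dif_pos (And.intro hs ht), dif_pos ht]
      rfl
    · exact (intervalSpace_subsingleton ht).elim _ _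
  · rw [(intervalSpace_subsingleton hs).elim x 0, map_zero, map_zero]

open Classical in
lemma finrank_range_pi_intervalMap {ι : Type} [Fintype ι] (I : ι → RealInterval) (s t : ℝ) :
    finrank ℝ (LinearMap.range
      (LinearMap.pi fun k => intervalMap (I k) s t ∘ₗ LinearMap.proj (R := ℝ) k)) =
      Fintype.card {k // s ∈ (I k).1 ∧ t ∈ (I k).1} := by
  let K := {k // s ∈ (I k).1 ∧ t ∈ (I k).1}
  let restriction : (∀ k, intervalSpace (I k) s) →ₗ[ℝ] K → ℝ :=
    LinearMap.pi fun k => (intervalSpace (I k) s).subtype ∘ₗ LinearMap.proj k.1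
  let extension : (K → ℝ) →ₗ[ℝ] ∀ k, intervalSpace (I k) t :=
    LinearMap.pi fun k =>
      if hk : s ∈ (I k).1 ∧ t ∈ (I k).1 then intervalProj (I k) t ∘ₗ LinearMap.proj ⟨k, hk⟩ else 0
  have factorization :
      (LinearMap.pi fun k => intervalMap (I k) s t ∘ₗ LinearMap.proj (R := ℝ) k) =
        extension ∘ₗ restriction := by
    refine LinearMap.ext fun x => funext fun k => ?_
    by_cases hk : s ∈ (I k).1 ∧ t ∈ (I k).1
    · simp [extension, restriction, hk, intervalMap_eq_intervalProj_comp]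
    · simp [extension, hk, intervalMap]
  have restriction_surjective : Function.Surjective restriction := fun y =>
    ⟨fun k => if hk : s ∈ (I k).1 ∧ t ∈ (I k).1 then intervalProj (I k) s (y ⟨k, hk⟩) else 0, by
      ext k
      simp [restriction, k.2, intervalProj_apply_of_mem]⟩
  have extension_injective : Function.Injective extension := fun x y hxy => by
    ext k
    simpa [extension, k.2, intervalProj_apply_of_mem] using
      congrArg Subtype.val (congrFun hxy k.1)
  rw [factorization, LinearMap.range_comp_of_range_eq_top _
    (LinearMap.range_eq_top.2 restriction_surjective),
    LinearMap.finrank_range_of_inj extension_injective, finrank_fintype_fun_eq_card]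

open Classical in
lemma IsBarcode.finrank_range_map (hB : IsBarcode M B) (f : s ⟶ t) :
    finrank ℝ (LinearMap.range (M.map f).hom) = B.countP fun I => s ∈ I.1 ∧ t ∈ I.1 := by
  obtain ⟨α⟩ := hB
  let e (r : ℝ) : M.obj r ≃ₗ[ℝ] ∀ k : B, intervalSpace k.1 r := (α.app r).toLinearEquiv
  have naturality : (e t).toLinearMap ∘ₗ (M.map f).hom =
      (LinearMap.pi fun k : B => intervalMap k.1 s t ∘ₗ LinearMap.proj k) ∘ₗ
        (e s).toLinearMap := by
    ext1 x
    exact congrArg (fun h => h.hom x) (α.hom.naturality f)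
  have card_bars : Fintype.card {k : B // s ∈ k.1.1 ∧ t ∈ k.1.1} =
      B.countP fun I => s ∈ I.1 ∧ t ∈ I.1 := by
    conv_rhs => rw [← Multiset.map_univ_coe B, Multiset.countP_map]
    exact Fintype.card_subtype _
  rw [← card_bars, ← finrank_range_pi_intervalMap,
    ← LinearMap.range_comp_of_range_eq_top _ (e s).range, ← naturality, LinearMap.range_comp]
  exact ((e t).finrank_map_eq _).symm

lemma exists_mem_pair_separating (I : RealInterval) (S : Finset RealInterval)
    (hS : ∀ J ∈ S, ¬ I.1 ⊆ J.1) :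
    ∃ s t : ℝ, s ≤ t ∧ s ∈ I.1 ∧ t ∈ I.1 ∧ ∀ J ∈ S, ¬ (s ∈ J.1 ∧ t ∈ J.1) := by
  classical
  induction S using Finset.induction_on with
  | empty =>
    obtain ⟨s, hs⟩ := I.2.2
    exact ⟨s, s, le_rfl, hs, hs, by simp⟩
  | insert J S _ ih =>
    obtain ⟨s, t, hst, hs, ht, hsep⟩ := ih fun K hK => hS K (Finset.mem_insert_of_mem hK)
    obtain ⟨x, hxI, hxJ⟩ := Set.not_subset.1 (hS J (Finset.mem_insert_self J S))
    have hull {K : RealInterval} (h : min s x ∈ K.1 ∧ max t x ∈ K.1) {y : ℝ}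
        (hy : min s x ≤ y ∧ y ≤ max t x) : y ∈ K.1 := K.2.1.out h.1 h.2 hy
    refine ⟨min s x, max t x, by simp [hst], ?_, ?_, ?_⟩
    · rcases min_choice s x with h | h <;> rwa [h]
    · rcases max_choice t x with h | h <;> rwa [h]
    · refine Finset.forall_mem_insert _ _ _ |>.2 ⟨fun h => hxJ (hull h (by simp)), ?_⟩
      exact fun K hK h => hsep K hK ⟨hull h (by simp [hst]), hull h (by simp [hst])⟩

open Classical in
lemma mem_of_maximal_of_countP_eq
    (h : ∀ s t, s ≤ t → B.countP (fun J => s ∈ J.1 ∧ t ∈ J.1) =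
      B'.countP fun J => s ∈ J.1 ∧ t ∈ J.1)
    (hI : I ∈ B) (hmax : ∀ J ∈ B', I.1 ⊆ J.1 → J = I) : I ∈ B' := by
  by_contra hI'
  obtain ⟨s, t, hst, hs, ht, hsep⟩ := exists_mem_pair_separating I B'.toFinset fun J hJ hIJ =>
    hI' (hmax J (Multiset.mem_toFinset.1 hJ) hIJ ▸ Multiset.mem_toFinset.1 hJ)
  have hB : 0 < B.countP fun J => s ∈ J.1 ∧ t ∈ J.1 := Multiset.countP_pos.2 ⟨I, hI, hs, ht⟩
  obtain ⟨J, hJ, hmem⟩ := Multiset.countP_pos.1 (h s t hst ▸ hB)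
  exact hsep J (Multiset.mem_toFinset.2 hJ) hmem

open Classical in
lemma eq_of_countP_eq
    (h : ∀ s t, s ≤ t → B.countP (fun J => s ∈ J.1 ∧ t ∈ J.1) =
      B'.countP fun J => s ∈ J.1 ∧ t ∈ J.1) : B = B' := by
  have hdiff : ∀ s t, s ≤ t → (B - B').countP (fun J => s ∈ J.1 ∧ t ∈ J.1) =
      (B' - B).countP fun J => s ∈ J.1 ∧ t ∈ J.1 := fun s t hst => by
    refine add_right_cancel (b := (B ∩ B').countP fun J => s ∈ J.1 ∧ t ∈ J.1) ?_
    rw [← Multiset.countP_add, Multiset.sub_add_inter, h s t hst, Multiset.inter_comm,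
      ← Multiset.countP_add, Multiset.sub_add_inter]
  have not_mem_both (I : RealInterval) : ¬ (I ∈ B - B' ∧ I ∈ B' - B) := fun hI => by
    have h1 := Multiset.mem_sub.1 hI.1
    have h2 := Multiset.mem_sub.1 hI.2
    exact h1.asymm h2
  suffices hempty : (B - B') + (B' - B) = 0 by
    obtain ⟨h1, h2⟩ := add_eq_zero.1 hempty
    exact le_antisymm (tsub_eq_zero_iff_le.1 h1) (tsub_eq_zero_iff_le.1 h2)
  by_contra hne
  obtain ⟨I, hI, hmax⟩ := ((B - B') + (B' - B)).toFinset.exists_maximalFor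
    (fun I : RealInterval => I.1) (Multiset.toFinset_nonempty.2 hne)
  simp only [Multiset.mem_toFinset, Multiset.mem_add] at hI hmax
  have eq_of_subset (J) (hJ : J ∈ B - B' ∨ J ∈ B' - B) (hIJ : I.1 ⊆ J.1) : J = I :=
    Subtype.ext ((hmax hJ hIJ).antisymm hIJ)
  rcases hI with hI | hI
  · exact not_mem_both I
      ⟨hI, mem_of_maximal_of_countP_eq hdiff hI fun J hJ => eq_of_subset J (.inr hJ)⟩
  · exact not_mem_both I ⟨mem_of_maximal_of_countP_eq (fun s t hst => (hdiff s t hst).symm) hI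
      fun J hJ => eq_of_subset J (.inl hJ), hI⟩

theorem IsBarcode.unique (hB : IsBarcode M B) (hB' : IsBarcode M B') : B = B' :=
  eq_of_countP_eq fun _ _ hst =>
    (hB.finrank_range_map (homOfLE hst)).symm.trans (hB'.finrank_range_map (homOfLE hst))

lemma IsBarcode.isBarcode_iff (hB : IsBarcode M B) : IsBarcode M B' ↔ B' = B :=
  ⟨fun hB' => hB'.unique hB, fun h => h ▸ hB⟩

lemma IsBarcode.barcode_eq (hB : IsBarcode M B) : barcode M = B :=
  (Classical.epsilon_spec ⟨B, hB⟩ : IsBarcode M (barcode M)).unique hB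

open Classical in
lemma isBarcode_of_bijective (φ : ∀ t, M.obj t →ₗ[ℝ] ∀ k : B, intervalSpace k.1 t)
    (hφ : ∀ t, Function.Bijective (φ t))
    (naturality : ∀ {s t} (f : s ⟶ t) x k, φ t (M.map f x) k = intervalMap k.1 s t (φ s x k)) :
    IsBarcode M B :=
  ⟨NatIso.ofComponents (fun t => (LinearEquiv.ofBijective (φ t) (hφ t)).toModuleIso) fun f => by
    ext x
    exact funext (naturality f x)⟩

lemma isBarcode_zero (hM : ∀ t, Subsingleton (M.obj t)) : IsBarcode M 0 :=
  isBarcode_of_bijective (fun _ => 0)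
    (fun t => ⟨fun x y _ => (hM t).elim x y, fun _ => ⟨0, Subsingleton.elim _ _⟩⟩)
    fun _ _ k => isEmptyElim k

lemma isBarcode_singleton (φ : ∀ t, M.obj t →ₗ[ℝ] intervalSpace J t)
    (hφ : ∀ t, Function.Bijective (φ t))
    (naturality : ∀ {s t} (f : s ⟶ t) x, φ t (M.map f x) = intervalMap J s t (φ s x)) :
    IsBarcode M {J} := by
  classical
  have transport (k : ({J} : Barcode)) : ∃ e : ∀ t, intervalSpace J t ≃ₗ[ℝ] intervalSpace k.1 t,
      ∀ s t z, e t (intervalMap J s t z) = intervalMap k.1 s t (e s z) := by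
    rw [show k.1 = J from Multiset.mem_singleton.1 Multiset.coe_mem]
    exact ⟨fun _ => .refl _ _, fun _ _ _ => rfl⟩
  choose coord coord_intervalMap using transport
  obtain ⟨k₀, hk₀⟩ := Fintype.card_eq_one_iff.1 (Multiset.card_coe {J})
  refine isBarcode_of_bijective (fun t => LinearMap.pi fun k => (coord k t).toLinearMap ∘ₗ φ t)
    (fun t => ⟨fun x y hxy => (hφ t).1 ((coord k₀ t).injective (congrFun hxy k₀)), fun y => ?_⟩)
    fun f x k => (congrArg (coord k _) (naturality f x)).trans (coord_intervalMap k _ _ _)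
  obtain ⟨x, hx⟩ := (hφ t).2 ((coord k₀ t).symm (y k₀))
  refine ⟨x, funext fun k => ?_⟩
  rw [hk₀ k]
  exact (congrArg (coord k₀ t) hx).trans ((coord k₀ t).apply_symm_apply _)

end IntervalModules

section Bottleneck

variable {a b : ℝ}

lemma endpoints_icoBar (h : a < b) : (icoBar a b h).endpoints = ((a : EReal), (b : EReal)) := by
  have hab : (a : EReal) < b := EReal.coe_lt_coe_iff.2 h
  simp only [RealInterval.endpoints, icoBar, EReal.image_coe_Ico, csInf_Ico hab, csSup_Ico hab]

lemma eDist_coe (x y : ℝ) : eDist (x : EReal) y = ENNReal.ofReal |x - y| := by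
  by_cases hxy : x = y
  · simp [eDist, hxy]
  · rw [eDist, if_neg (EReal.coe_injective.ne hxy), ← EReal.coe_sub, EReal.abs_def]

lemma pointDist_coe_le_ofReal_iff {x₁ x₂ y₁ y₂ r : ℝ} (hr : 0 ≤ r) :
    pointDist ((x₁ : EReal), (x₂ : EReal)) ((y₁ : EReal), (y₂ : EReal)) ≤ ENNReal.ofReal r ↔
      |x₁ - y₁| ≤ r ∧ |x₂ - y₂| ≤ r := by
  simp only [pointDist, eDist_coe, max_le_iff, ENNReal.ofReal_le_ofReal_iff hr]

open Classical in
lemma bottleneckDist_le_of_injective {B₁ B₂ : Barcode} {r : ENNReal}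
    {f : B₁ ⊕ ℝ → B₂ ⊕ ℝ} {g : B₂ ⊕ ℝ → B₁ ⊕ ℝ}
    (hf : Function.Injective f) (hg : Function.Injective g)
    (hfr : ∀ x, pointDist (diagramPoint B₁ x) (diagramPoint B₂ (f x)) ≤ r)
    (hgr : ∀ y, pointDist (diagramPoint B₁ (g y)) (diagramPoint B₂ y) ≤ r) :
    bottleneckDist B₁ B₂ ≤ r := by
  obtain ⟨h, hh, hhr⟩ := Function.Embedding.schroeder_bernstein_of_rel hf hg
    (fun x y => pointDist (diagramPoint B₁ x) (diagramPoint B₂ y) ≤ r) hfr hgr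
  exact iInf_le_of_le (Equiv.ofBijective h hh) (iSup_le hhr)

open Classical in
/-- The matching of a diagram with at most one bar to the diagonal: the bar goes to `(m, m)`, and
the diagonal makes room for it by moving its points from `m` upwards by `r`. -/
def shiftDiagonal {ι κ : Type} (m r : ℝ) : ι ⊕ ℝ → κ ⊕ ℝ :=
  Sum.elim (fun _ => .inr m) fun x => .inr (if x < m then x else x + r)

lemma shiftDiagonal_injective {ι κ : Type} [Subsingleton ι] {m r : ℝ} (hr : 0 < r) :
    Function.Injective (shiftDiagonal m r : ι ⊕ ℝ → κ ⊕ ℝ) := by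
  rintro (k | x) (l | y) hxy <;>
    simp only [shiftDiagonal, Sum.elim_inl, Sum.elim_inr, Sum.inr.injEq] at hxy
  · rw [Subsingleton.elim k l]
  · split_ifs at hxy <;> linarith
  · split_ifs at hxy <;> linarith
  · congr
    split_ifs at hxy <;> linarith

lemma bottleneckDist_icoBar_zero_le (h : a < b) :
    bottleneckDist {icoBar a b h} 0 ≤ ENNReal.ofReal ((b - a) / 2) := by
  classical
  have hr : 0 < (b - a) / 2 := by linarith
  have := Fintype.card_le_one_iff_subsingleton.1 (Multiset.card_coe {icoBar a b h}).le
  refine bottleneckDist_le_of_injective (shiftDiagonal_injective (m := (a + b) / 2) hr)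
    (g := Sum.elim isEmptyElim Sum.inr) ?_ ?_ ?_
  · rintro (k | x) (l | y) hxy
    all_goals first | exact isEmptyElim k | exact isEmptyElim l | exact congrArg _ (Sum.inr.inj hxy)
  · rintro (k | x)
    · have hk : k.1 = icoBar a b h := Multiset.mem_singleton.1 Multiset.coe_mem
      simp only [diagramPoint, shiftDiagonal, Sum.elim_inl, Sum.elim_inr, hk, endpoints_icoBar,
        pointDist_coe_le_ofReal_iff hr.le, abs_le]
      constructor <;> constructor <;> linarith
    · simp only [diagramPoint, shiftDiagonal, Sum.elim_inr, pointDist_coe_le_ofReal_iff hr.le,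
        and_self, abs_le]
      split_ifs <;> constructor <;> linarith
  · rintro (k | y)
    · exact isEmptyElim k
    · simp only [diagramPoint, Sum.elim_inr, pointDist_coe_le_ofReal_iff hr.le, sub_self, abs_zero,
        hr.le, and_self]

lemma ofReal_half_le_bottleneckDist_icoBar_zero (h : a < b) :
    ENNReal.ofReal ((b - a) / 2) ≤ bottleneckDist {icoBar a b h} 0 := by
  classical
  refine le_iInf fun γ => ?_
  obtain ⟨k, -⟩ := Fintype.card_eq_one_iff.1 (Multiset.card_coe {icoBar a b h})
  refine le_iSup_of_le (.inl k) ?_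
  rcases γ (.inl k) with l | x
  · exact isEmptyElim l
  · have hk : k.1 = icoBar a b h := Multiset.mem_singleton.1 Multiset.coe_mem
    simp only [diagramPoint, Sum.elim_inl, Sum.elim_inr, hk, endpoints_icoBar, pointDist, eDist_coe,
      ← ENNReal.ofReal_max]
    refine ENNReal.ofReal_le_ofReal ?_
    rcases le_total x ((a + b) / 2) with hx | hx
    · exact le_max_of_le_right (le_abs.2 (.inl (by linarith)))
    · exact le_max_of_le_left (le_abs.2 (.inr (by linarith)))

theorem bottleneckDist_icoBar_zero (h : a < b) :
    bottleneckDist {icoBar a b h} 0 = ENNReal.ofReal ((b - a) / 2) :=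
  (bottleneckDist_icoBar_zero_le h).antisymm (ofReal_half_le_bottleneckDist_icoBar_zero h)

end Bottleneck

section PathComplex

variable {V : Type} {p : ℕ} {F : Set (V × V)}

/-- The cone with apex `a`, which prepends `a` to every path. It is a contracting homotopy of the
non-regular complex. -/
def cone (a : V) (p : ℕ) : Chains V p →ₗ[ℝ] Chains V (p + 1) :=
  Finsupp.lmapDomain ℝ ℝ fun x : Fin (p + 1) → V => (Fin.cons a x : Fin (p + 2) → V)

lemma cone_single (a : V) (x : Fin (p + 1) → V) (r : ℝ) :
    cone a p (.single x r) = .single (Fin.cons a x) r :=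
  Finsupp.mapDomain_single

lemma nregBoundary_single (x : Fin (p + 2) → V) (r : ℝ) :
    nregBoundary V p (.single x r) =
      ∑ i : Fin (p + 2), Finsupp.single (fun j => x (i.succAbove j)) ((-1) ^ (i : ℕ) * r) := by
  simp only [nregBoundary, Finsupp.linearCombination_single, Finset.smul_sum, Finsupp.smul_single,
    smul_eq_mul, mul_comm r]

lemma nregBoundary_cone (a : V) (c : Chains V (p + 1)) :
    nregBoundary V (p + 1) (cone a (p + 1) c) = c - cone a p (nregBoundary V p c) := by
  induction c using Finsupp.induction_linear with
  | zero => simp only [map_zero, sub_zero]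
  | add c d hc hd => rw [map_add, map_add, map_add, map_add, hc, hd, add_sub_add_comm]
  | single x r =>
    have face_succ (i : Fin (p + 2)) :
        (fun j => (Fin.cons a x : Fin (p + 3) → V) (i.succ.succAbove j)) =
          Fin.cons a fun j => x (i.succAbove j) := by
      funext j
      cases j using Fin.cases <;> simp [Fin.succ_succAbove_succ]
    rw [cone_single, nregBoundary_single, Fin.sum_univ_succ, nregBoundary_single, map_sum]
    simp only [cone_single, face_succ, Fin.val_zero, pow_zero, one_mul, Fin.zero_succAbove,
      Fin.cons_succ, Fin.val_succ, pow_succ', neg_mul, Finsupp.single_neg, Finset.sum_neg_distrib,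
      sub_eq_add_neg]

lemma not_isRegular_cons {a : V} {x : Fin (p + 1) → V} (hx : ¬ IsRegular x) :
    ¬ IsRegular (Fin.cons a x : Fin (p + 2) → V) :=
  fun h => hx fun i => by simpa using h i.succ

lemma regProj_cone_regProj (a : V) (c : Chains V p) :
    regProj V (p + 1) (cone a p (regProj V p c)) = regProj V (p + 1) (cone a p c) := by
  induction c using Finsupp.induction_linear with
  | zero => simp only [map_zero]
  | add c d hc hd => simp only [map_add, hc, hd]
  | single x r =>
    by_cases hx : IsRegular x
    · rw [regProj_single x r hx]
    · rw [regProj_single_of_not x r hx, cone_single, map_zero, map_zero,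
        regProj_single_of_not _ r (not_isRegular_cons hx)]

lemma boundary_cone (a : V) (c : Chains V (p + 1)) :
    boundary V (p + 1) (cone a (p + 1) c) =
      regProj V (p + 1) c - regProj V (p + 1) (cone a p (boundary V p c)) := by
  simp only [boundary, LinearMap.comp_apply, regProj_cone_regProj, nregBoundary_cone, map_sub]

lemma not_isRegular_succAbove {x : Fin (p + 2) → V} {i : Fin (p + 1)}
    (hi : x i.castSucc = x i.succ) {k : Fin (p + 2)} (hk : k ≠ i.castSucc) (hk' : k ≠ i.succ) :
    ¬ IsRegular fun j => x (k.succAbove j) := by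
  obtain ⟨u, hu⟩ := Fin.exists_succAbove_eq hk.symm
  obtain ⟨v, hv⟩ := Fin.exists_succAbove_eq hk'.symm
  have consecutive : (v : ℕ) = u + 1 := by
    simp only [Fin.succAbove, Fin.lt_def, Fin.ext_iff, Fin.val_castSucc, ne_eq, Fin.val_succ]
      at hu hv hk hk'
    split_ifs at hu hv <;> simp only [Fin.val_castSucc, Fin.val_succ] at hu hv <;> omega
  intro hreg
  have hu' : (⟨u, by omega⟩ : Fin p).castSucc = u := rfl
  have hv' : (⟨u, by omega⟩ : Fin p).succ = v := Fin.ext consecutive.symm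
  exact hreg ⟨u, by omega⟩ (by simp only [hu', hv', hu, hv, hi])

lemma boundary_single_of_not_isRegular {x : Fin (p + 2) → V} (hx : ¬ IsRegular x) (r : ℝ) :
    boundary V p (.single x r) = 0 := by
  obtain ⟨i, hi⟩ : ∃ i : Fin (p + 1), x i.castSucc = x i.succ := by
    simpa only [IsRegular, not_forall, not_not] using hx
  have face_eq : (fun j => x (i.succ.succAbove j)) = fun j => x (i.castSucc.succAbove j) := by
    funext j
    rcases lt_trichotomy j i with hj | rfl | hj
    · rw [Fin.succAbove_of_castSucc_lt _ _ (Fin.castSucc_lt_succ_iff.2 hj.le),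
        Fin.succAbove_of_castSucc_lt _ _ hj]
    · simp only [Fin.succAbove_succ_self, Fin.succAbove_castSucc_self, hi]
    · rw [Fin.succAbove_of_lt_succ _ _ (Fin.succ_lt_succ_iff.2 hj),
        Fin.succAbove_of_le_castSucc _ _ hj.le]
  rw [boundary, LinearMap.comp_apply, nregBoundary_single, map_sum,
    Finset.sum_eq_add i.castSucc i.succ Fin.castSucc_lt_succ.ne
      (fun k _ hk => regProj_single_of_not _ _ (not_isRegular_succAbove hi hk.1 hk.2))
      (absurd (Finset.mem_univ _)) (absurd (Finset.mem_univ _)),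
    face_eq, ← map_add, ← Finsupp.single_add]
  simp [pow_succ]

lemma boundary_regProj (c : Chains V (p + 1)) :
    boundary V p (regProj V (p + 1) c) = boundary V p c := by
  induction c using Finsupp.induction_linear with
  | zero => simp only [map_zero]
  | add c d hc hd => simp only [map_add, hc, hd]
  | single x r =>
    by_cases hx : IsRegular x
    · rw [regProj_single x r hx]
    · rw [regProj_single_of_not x r hx, map_zero, boundary_single_of_not_isRegular hx]

lemma regProj_eq_self (hF : ∀ v, (v, v) ∉ F) {c : Chains V p} (hc : c ∈ allowedChains F p) :
    regProj V p c = c := by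
  have isRegular_of_isAllowed {x : Fin (p + 1) → V} (hx : IsAllowed F x) : IsRegular x :=
    fun i hi => hF _ (hi ▸ hx i)
  conv_lhs => rw [← Finsupp.sum_single c, map_finsuppSum]
  conv_rhs => rw [← Finsupp.sum_single c]
  exact Finsupp.sum_congr fun x hx =>
    regProj_single x _ (isRegular_of_isAllowed ((Finsupp.mem_supported ℝ c).1 hc hx))

theorem mem_map_boundary_of_cone (hF : ∀ v, (v, v) ∉ F) {c : Chains V (p + 1)}
    (hc : c ∈ allowedChains F (p + 1)) (hcycle : boundary V p c = 0) (a : V)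
    (ha : ∀ x, c x ≠ 0 → a ≠ x 0 → (a, x 0) ∈ F) :
    c ∈ (omegaSucc F (p + 1)).map (boundary V (p + 1)) := by
  have hfill : boundary V (p + 1) (regProj V (p + 2) (cone a (p + 1) c)) = c := by
    rw [boundary_regProj, boundary_cone, hcycle, map_zero, map_zero, sub_zero,
      regProj_eq_self hF hc]
  refine ⟨_, ⟨?_, ?_⟩, hfill⟩
  · rw [← Finsupp.sum_single c, map_finsuppSum, map_finsuppSum]
    refine Submodule.sum_mem _ fun x hx =>
      (?_ : regProj V (p + 2) (cone a (p + 1) (.single x (c x))) ∈ _)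
    rw [cone_single]
    by_cases hreg : IsRegular (Fin.cons a x : Fin (p + 3) → V)
    · rw [regProj_single _ _ hreg]
      refine Finsupp.single_mem_supported ℝ _ fun i => ?_
      cases i using Fin.cases with
      | zero => exact ha x (Finsupp.mem_support_iff.1 hx) (hreg 0)
      | succ i => simpa using (Finsupp.mem_supported ℝ c).1 hc hx i
    · rw [regProj_single_of_not _ _ hreg]
      exact zero_mem _
  · rwa [SetLike.mem_coe, Submodule.mem_comap, hfill]

end PathComplex

section Suspension

variable {V : Type} {F : Set (V × V)} {a z : V} {c : Chains V 1}

lemma exists_eq_vecPair (x : Fin 2 → V) : ∃ u v, x = ![u, v] :=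
  ⟨x 0, x 1, (FinVec.etaExpand_eq x).symm⟩

lemma mem_allowedChains_one_iff :
    c ∈ allowedChains F 1 ↔ ∀ u v, c ![u, v] ≠ 0 → (u, v) ∈ F := by
  rw [allowedChains, Finsupp.mem_supported]
  refine ⟨fun h u v huv => h (Finsupp.mem_support_iff.2 huv) 0, fun h x hx i => ?_⟩
  obtain rfl := Subsingleton.elim i 0
  obtain ⟨u, v, rfl⟩ := exists_eq_vecPair x
  exact h u v (Finsupp.mem_support_iff.1 hx)

lemma single_mem_allowedChains_one {u v : V} (h : (u, v) ∈ F) (r : ℝ) :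
    .single ![u, v] r ∈ allowedChains F 1 :=
  Finsupp.single_mem_supported ℝ r fun i => by
    obtain rfl := Subsingleton.elim i 0
    exact h

lemma boundary_zero_apply [Fintype V] (c : Chains V 1) (v : V) :
    boundary V 0 c ![v] = ∑ u, c ![u, v] - ∑ u, c ![v, u] := by
  classical
  induction c using Finsupp.induction_linear with
  | zero => simp
  | add c d hc hd =>
    simp only [map_add, Finsupp.add_apply, hc, hd, Finset.sum_add_distrib]
    ring
  | single x r =>
    obtain ⟨u, w, rfl⟩ := exists_eq_vecPair x
    have pair_eq (y y' : V) : ![u, w] = ![y, y'] ↔ u = y ∧ w = y' := by simp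
    rw [boundary_edge]
    simp [Finsupp.single_apply, pair_eq, ite_and]

/-- The edges of the suspension of a discrete set with poles `a` and `z`, together with the edge
from `a` to `z`: an edge starts at `a` or ends at `z`. -/
def suspensionEdges (a z : V) : Set (V × V) := {τ | τ.1 ≠ τ.2 ∧ (τ.1 = a ∨ τ.2 = z)}

lemma apply_eq_apply_of_subset_suspensionEdges [Finite V] (hF : F ⊆ suspensionEdges a z)
    (hc : c ∈ allowedChains F 1) (hcycle : boundary V 0 c = 0) {m : V} (ha : m ≠ a) (hz : m ≠ z) :
    c ![a, m] = c ![m, z] := by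
  have := Fintype.ofFinite V
  have suspension {u v : V} (h : c ![u, v] ≠ 0) : u = a ∨ v = z :=
    (hF (mem_allowedChains_one_iff.1 hc u v h)).2
  have inflow : ∑ u, c ![u, m] = c ![a, m] :=
    Fintype.sum_eq_single a fun u hu => by
      by_contra h
      exact (suspension h).elim hu hz
  have outflow : ∑ u, c ![m, u] = c ![m, z] :=
    Fintype.sum_eq_single z fun u hu => by
      by_contra h
      exact (suspension h).elim ha hu
  have kirchhoff := boundary_zero_apply c m
  rw [hcycle, inflow, outflow] at kirchhoff
  exact sub_eq_zero.1 kirchhoff.symm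

lemma sum_apply_eq_zero_of_subset_suspensionEdges [Fintype V] (haz : a ≠ z)
    (hF : F ⊆ suspensionEdges a z) (hc : c ∈ allowedChains F 1) (hcycle : boundary V 0 c = 0) :
    ∑ v, c ![a, v] = 0 := by
  have inflow : ∑ u, c ![u, a] = 0 := Finset.sum_eq_zero fun u _ => by
    by_contra h
    obtain ⟨hne, h | h⟩ := hF (mem_allowedChains_one_iff.1 hc u a h)
    exacts [hne h, haz h]
  have kirchhoff := boundary_zero_apply c a
  rw [hcycle, inflow, zero_sub] at kirchhoff
  exact neg_eq_zero.1 kirchhoff.symm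

theorem mem_map_boundary_of_subset_suspensionEdges [Finite V]
    (hF : F ⊆ suspensionEdges a z) (hc : c ∈ allowedChains F 1) (hcycle : boundary V 0 c = 0) :
    c ∈ (omegaSucc F 1).map (boundary V 1) := by
  refine mem_map_boundary_of_cone (fun v hv => (hF hv).1 rfl) hc hcycle a fun x hx hxa => ?_
  obtain ⟨u, v, rfl⟩ := exists_eq_vecPair x
  obtain ⟨hne, h | h⟩ := hF (mem_allowedChains_one_iff.1 hc _ _ hx)
  · exact absurd h.symm hxa
  · refine mem_allowedChains_one_iff.1 hc a u ?_
    obtain rfl : v = z := h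
    rwa [apply_eq_apply_of_subset_suspensionEdges hF hc hcycle (m := u) hxa.symm hne]

end Suspension

section ShortestPathFiltration

variable {G : WDgr} {i j : G.V} {t : ℝ}

lemma WDgr.mem_filtEdges_of_edge (h : (i, j) ∈ G.E) (ht : G.w ⟨(i, j), h⟩ ≤ t) :
    (i, j) ∈ G.filtEdges t := by
  have hne : i ≠ j := fun hij => G.loopless i (hij ▸ h)
  let p : G.Walk i j := .cons h (.nil j)
  have hp : p.IsPath := by simp [p, WDgr.Walk.IsPath, WDgr.Walk.support, hne]
  have hlength : p.length = G.w ⟨(i, j), h⟩ := by simp [p, WDgr.Walk.length]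
  exact ⟨hne, iInf₂_le_of_le p hp (EReal.coe_le_coe_iff.2 (hlength.trans_le ht))⟩

lemma WDgr.nonempty_walk_of_mem_filtEdges (h : (i, j) ∈ G.filtEdges t) :
    Nonempty (G.Walk i j) := by
  by_contra hp
  rw [not_nonempty_iff] at hp
  exact (EReal.coe_lt_top t).not_ge (by simpa [WDgr.dist, iInf_of_empty] using h.2)

lemma WDgr.filtEdges_subset_suspensionEdges {a z : G.V} (haz : a ≠ z)
    (hE : G.E ⊆ suspensionEdges a z) : G.filtEdges t ⊆ suspensionEdges a z := by
  rintro ⟨i, j⟩ hij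
  obtain ⟨p⟩ := WDgr.nonempty_walk_of_mem_filtEdges hij
  refine ⟨hij.1, ?_⟩
  rcases p with _ | ⟨e, _ | ⟨e', _⟩⟩
  · exact absurd rfl hij.1
  · exact (hE e).2
  · refine .inl ((hE e).2.resolve_right fun hz => ?_)
    obtain ⟨hne, h | h⟩ := hE e'
    · exact haz (h.symm.trans hz)
    · exact hne (hz.trans h.symm)

lemma WDgr.groundedEdges_subset_suspensionEdges {a z : G.V} (haz : a ≠ z)
    (hE : G.E ⊆ suspensionEdges a z) : G.groundedEdges t ⊆ suspensionEdges a z :=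
  fun _ hτ => hτ.2.elim (fun h => hE h) fun h => WDgr.filtEdges_subset_suspensionEdges haz hE h

lemma WDgr.exists_edge_of_mem_filtEdges (h : (i, j) ∈ G.filtEdges t) : ∃ k, (i, k) ∈ G.E := by
  obtain ⟨_ | ⟨e, _⟩⟩ := WDgr.nonempty_walk_of_mem_filtEdges h
  · exact absurd rfl h.1
  · exact ⟨_, e⟩

lemma WDgr.Walk.sub_le_length {π : G.V → ℝ} (hπ : ∀ e : G.E, π e.1.2 - π e.1.1 ≤ G.w e)
    (p : G.Walk i j) : π j - π i ≤ p.length := by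
  induction p with
  | nil i => simp [WDgr.Walk.length]
  | cons e p ih =>
    simp only [WDgr.Walk.length]
    linarith [hπ ⟨_, e⟩]

lemma WDgr.sub_le_of_mem_filtEdges {π : G.V → ℝ} (hπ : ∀ e : G.E, π e.1.2 - π e.1.1 ≤ G.w e)
    (h : (i, j) ∈ G.filtEdges t) : π j - π i ≤ t :=
  EReal.coe_le_coe_iff.1 <| (le_iInf₂ fun p _ => EReal.coe_le_coe_iff.2 (p.sub_le_length hπ)).trans
    h.2

end ShortestPathFiltration

section GroundedHomology

variable {G : WDgr} {t : ℝ} {c : Chains G.V 1}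

lemma WDgr.mem_cycles_iff :
    c ∈ G.cycles t ↔ c ∈ allowedChains (G.groundedEdges t) 1 ∧ boundary G.V 0 c = 0 := by
  have allowed_zero (d : Chains G.V 0) : d ∈ allowedChains (G.groundedEdges t) 0 :=
    (Finsupp.mem_supported ℝ _).2 fun _ _ i => i.elim0
  simp only [WDgr.cycles, omegaSucc, Submodule.mem_inf, Submodule.mem_comap, allowed_zero, and_true,
    LinearMap.mem_ker]

lemma WDgr.mem_allowedChains_of_mem_boundaries (hc : c ∈ G.boundaries t) :
    c ∈ allowedChains (G.filtEdges t) 1 := by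
  obtain ⟨_, hd, rfl⟩ := hc
  exact hd.2

lemma WDgr.mem_boundaries_iff_of_subset_suspensionEdges {a z : G.V} (haz : a ≠ z)
    (hE : G.E ⊆ suspensionEdges a z) (hc : c ∈ G.cycles t) :
    c ∈ G.boundaries t ↔ c ∈ allowedChains (G.filtEdges t) 1 := by
  have := G.finite
  exact ⟨WDgr.mem_allowedChains_of_mem_boundaries, fun h =>
    mem_map_boundary_of_subset_suspensionEdges (WDgr.filtEdges_subset_suspensionEdges haz hE) h
      (WDgr.mem_cycles_iff.1 hc).2⟩

lemma WDgr.subsingleton_homology (h : G.cycles t ≤ G.boundaries t) :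
    Subsingleton (G.homology t) :=
  Submodule.subsingleton_iff_eq_bot.2 <| eq_bot_iff.2 <|
    Submodule.map_le_iff_le_comap.2 (h.trans_eq (G.boundaries t).ker_mkQ.symm)

theorem WDgr.isBarcode_persHomology_singleton {J : RealInterval} (coord : Chains G.V 1 →ₗ[ℝ] ℝ)
    (mem_boundaries_iff : ∀ t, ∀ c ∈ G.cycles t, c ∈ G.boundaries t ↔ (t ∈ J.1 → coord c = 0))
    (exists_cycle : ∀ t ∈ J.1, ∃ c ∈ G.cycles t, coord c ≠ 0) :
    IsBarcode G.persHomology {J} := by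
  have boundaries_le (t : ℝ) : G.boundaries t ≤ LinearMap.ker (intervalProj J t ∘ₗ coord) :=
    fun c hc => intervalProj_eq_zero_iff.2
      ((mem_boundaries_iff t c (G.boundaries_le_cycles t hc)).1 hc)
  refine isBarcode_singleton (fun t => ((G.boundaries t).liftQ (intervalProj J t ∘ₗ coord)
    (boundaries_le t)).domRestrict (G.homology t)) (fun t => ⟨?_, fun r => ?_⟩) ?_
  · refine (injective_iff_map_eq_zero _).2 ?_
    rintro ⟨_, c, hc, rfl⟩ hzero
    exact Subtype.ext ((Submodule.Quotient.mk_eq_zero _).2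
      ((mem_boundaries_iff t c hc).2 (intervalProj_eq_zero_iff.1 hzero)))
  · by_cases ht : t ∈ J.1
    · obtain ⟨c, hc, hne⟩ := exists_cycle t ht
      refine ⟨⟨_, (r / coord c : ℝ) • c, Submodule.smul_mem _ _ hc, rfl⟩,
        Subtype.ext ((intervalProj_apply_of_mem ht _).trans ?_)⟩
      rw [map_smul, smul_eq_mul, div_mul_cancel₀ _ hne]
    · exact ⟨0, (intervalSpace_subsingleton ht).elim _ _⟩
  · rintro s t f ⟨_, c, hc, rfl⟩
    refine (?_ : intervalProj J t (coord c) = intervalMap J s t (intervalProj J s (coord c)))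
    by_cases hs : s ∈ J.1
    · rw [intervalMap_eq_intervalProj_comp, LinearMap.comp_apply, Submodule.subtype_apply,
        intervalProj_apply_of_mem hs]
    · have hzero : c ∈ G.boundaries s := (mem_boundaries_iff s c hc).2 fun h => absurd h hs
      rw [(intervalSpace_subsingleton hs).elim (intervalProj J s (coord c)) 0, map_zero]
      exact boundaries_le t (G.boundaries_mono f.le hzero)

end GroundedHomology

section FourVertices

variable {F F' : Set (Fin 4 × Fin 4)} {c : Chains (Fin 4) 1}

lemma cycle_relations_of_subset_suspensionEdges (hF : F ⊆ suspensionEdges 0 3)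
    (hc : c ∈ allowedChains F 1) (hcycle : boundary (Fin 4) 0 c = 0) :
    c ![0, 1] = c ![1, 3] ∧ c ![0, 2] = c ![2, 3] ∧ c ![0, 1] + c ![0, 2] + c ![0, 3] = 0 := by
  have no_loop : c ![0, 0] = 0 := by
    by_contra h
    exact (hF (mem_allowedChains_one_iff.1 hc 0 0 h)).1 rfl
  refine ⟨apply_eq_apply_of_subset_suspensionEdges hF hc hcycle (by decide) (by decide),
    apply_eq_apply_of_subset_suspensionEdges hF hc hcycle (by decide) (by decide), ?_⟩
  have outflow := sum_apply_eq_zero_of_subset_suspensionEdges (by decide) hF hc hcycle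
  rwa [Fin.sum_univ_four, no_loop, zero_add] at outflow

lemma mem_allowedChains_of_subset_suspensionEdges (hF : F ⊆ suspensionEdges 0 3)
    (hc : c ∈ allowedChains F 1) (h01 : c ![0, 1] ≠ 0 → (0, 1) ∈ F')
    (h13 : c ![1, 3] ≠ 0 → (1, 3) ∈ F') (h02 : c ![0, 2] ≠ 0 → (0, 2) ∈ F')
    (h23 : c ![2, 3] ≠ 0 → (2, 3) ∈ F') (h03 : c ![0, 3] ≠ 0 → (0, 3) ∈ F') :
    c ∈ allowedChains F' 1 := by
  refine mem_allowedChains_one_iff.2 fun u v huv => ?_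
  obtain ⟨hne, rfl | rfl⟩ : u ≠ v ∧ (u = 0 ∨ v = 3) := hF (mem_allowedChains_one_iff.1 hc u v huv)
  · fin_cases v
    exacts [absurd rfl hne, h01 huv, h02 huv, h03 huv]
  · fin_cases u
    exacts [h03 huv, h13 huv, h23 huv, absurd rfl hne]

end FourVertices

section Square

variable {W t : ℝ} {hW : 0 < W} {c : Chains (Fin 4) 1}

lemma squareEdge_mem (W : ℝ) (hW : 0 < W) : squareEdge W hW ∈ (square W hW).E :=
  .inr (.inl rfl)

lemma square_E_subset_suspensionEdges :
    (square W hW).E ⊆ suspensionEdges (0 : Fin 4) (3 : Fin 4) := by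
  have mem : ∀ τ : Fin 4 × Fin 4, τ = (0, 1) ∨ τ = (1, 3) ∨ τ = (0, 2) ∨ τ = (2, 3) →
      τ.1 ≠ τ.2 ∧ (τ.1 = 0 ∨ τ.2 = 3) := by decide
  exact mem

lemma zero_three_notMem_square_E : ((0 : Fin 4), (3 : Fin 4)) ∉ (square W hW).E := by
  have notMem : ((0 : Fin 4), (3 : Fin 4)) ∉ ({(0, 1), (1, 3), (0, 2), (2, 3)} : Set _) := by simp
  exact notMem

lemma square_w_zero_two (h : ((0 : Fin 4), (2 : Fin 4)) ∈ (square W hW).E) :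
    (square W hW).w ⟨((0 : Fin 4), (2 : Fin 4)), h⟩ = W := by
  simp [square]

lemma square_w_eq_one {τ : Fin 4 × Fin 4} (h : τ ∈ (square W hW).E) (hne : τ ≠ (0, 2)) :
    (square W hW).w ⟨τ, h⟩ = 1 :=
  if_neg hne

lemma sub_le_of_mem_square_filtEdges {i j : Fin 4} (h : (i, j) ∈ (square W hW).filtEdges t)
    (π : Fin 4 → ℝ) (h01 : π 1 - π 0 ≤ 1) (h13 : π 3 - π 1 ≤ 1) (h02 : π 2 - π 0 ≤ W)
    (h23 : π 3 - π 2 ≤ 1) : π j - π i ≤ t := by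
  refine WDgr.sub_le_of_mem_filtEdges (G := square W hW) (π := π) ?_ h
  rintro ⟨τ, rfl | rfl | rfl | rfl⟩ <;> simpa [square] using by linarith

lemma le_of_zero_two_mem_square_filtEdges
    (h : ((0 : Fin 4), (2 : Fin 4)) ∈ (square W hW).filtEdges t) : W ≤ t := by
  simpa using sub_le_of_mem_square_filtEdges h ![0, 0, W, 0] (by simp) (by simp) (by simp)
    (by simpa using by linarith)

lemma two_le_of_zero_three_mem_square_filtEdges (h1 : 1 ≤ W)
    (h : ((0 : Fin 4), (3 : Fin 4)) ∈ (square W hW).filtEdges t) : 2 ≤ t := by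
  simpa [one_add_one_eq_two] using sub_le_of_mem_square_filtEdges h ![0, 1, 1, 1 + 1] (by simp)
    (by simp) (by simpa using h1) (by simp)

lemma square_mem_boundaries_iff (h1 : 1 ≤ W) (hc : c ∈ (square W hW).cycles t) :
    c ∈ (square W hW).boundaries t ↔ (t ∈ Set.Ico 0 W → c ![0, 2] = 0) := by
  have poles_ne : (0 : Fin 4) ≠ 3 := by decide
  obtain ⟨hcE, hcycle⟩ := WDgr.mem_cycles_iff.1 hc
  obtain ⟨h13, h23, hsum⟩ := cycle_relations_of_subset_suspensionEdges
    (WDgr.groundedEdges_subset_suspensionEdges poles_ne square_E_subset_suspensionEdges) hcE hcycle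
  refine (WDgr.mem_boundaries_iff_of_subset_suspensionEdges poles_ne
    square_E_subset_suspensionEdges hc).trans ⟨fun h ht => ?_, fun h => ?_⟩
  · by_contra hne
    exact ht.2.not_ge (le_of_zero_two_mem_square_filtEdges (mem_allowedChains_one_iff.1 h _ _ hne))
  have mem_grounded {u v : Fin 4} : c ![u, v] ≠ 0 → (u, v) ∈ (square W hW).groundedEdges t :=
    mem_allowedChains_one_iff.1 hcE u v
  have zero_two (hne : c ![0, 2] ≠ 0) : W ≤ t := by
    by_contra! ht
    exact hne (h ⟨(mem_grounded hne).1, ht⟩)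
  have zero_three (hne : c ![0, 3] ≠ 0) :
      ((0 : Fin 4), (3 : Fin 4)) ∈ (square W hW).filtEdges t :=
    (mem_grounded hne).2.resolve_left zero_three_notMem_square_E
  have one_le (hne : c ![0, 1] ≠ 0) : 1 ≤ t := by
    by_cases h02 : c ![0, 2] = 0
    · have h03 : c ![0, 3] ≠ 0 := fun h03 => hne (by rwa [h02, h03, add_zero, add_zero] at hsum)
      linarith [two_le_of_zero_three_mem_square_filtEdges h1 (zero_three h03)]
    · exact h1.trans (zero_two h02)
  have mem_of_one_le {u v : Fin 4} (hE : (u, v) ∈ (square W hW).E) (hne : (u, v) ≠ (0, 2))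
      (ht : 1 ≤ t) : (u, v) ∈ (square W hW).filtEdges t :=
    WDgr.mem_filtEdges_of_edge hE ((square_w_eq_one hE hne).trans_le ht)
  refine mem_allowedChains_of_subset_suspensionEdges
    (WDgr.groundedEdges_subset_suspensionEdges poles_ne square_E_subset_suspensionEdges) hcE
    (fun h01 => mem_of_one_le (.inl rfl) (by decide) (one_le h01))
    (fun hne => mem_of_one_le (.inr (.inl rfl)) (by decide) (one_le (h13.trans_ne hne)))
    (fun h02 => WDgr.mem_filtEdges_of_edge (.inr (.inr (.inl rfl)))
      ((square_w_zero_two _).trans_le (zero_two h02)))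
    (fun hne => mem_of_one_le (.inr (.inr (.inr rfl))) (by decide)
      (h1.trans (zero_two (h23.trans_ne hne)))) zero_three

/-- The cycle through `v₀v₂v₃` and back through `v₁`, which spans the grounded cycles of
`square W hW` as long as no shortcut from `v₀` to `v₃` has appeared. -/
def squareCycle : Chains (Fin 4) 1 :=
  .single ![0, 2] 1 + .single ![2, 3] 1 - .single ![0, 1] 1 - .single ![1, 3] 1

lemma squareCycle_zero_two : squareCycle ![0, 2] = 1 := by
  simp [squareCycle]

lemma squareCycle_mem_cycles (ht : 0 ≤ t) : squareCycle ∈ (square W hW).cycles t := by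
  have edge_mem {u v : Fin 4} (h : (u, v) ∈ (square W hW).E) :
      .single ![u, v] 1 ∈ allowedChains ((square W hW).groundedEdges t) 1 :=
    single_mem_allowedChains_one (And.intro ht (.inl h)) 1
  refine WDgr.mem_cycles_iff.2 ⟨?_, ?_⟩
  · exact sub_mem (sub_mem (add_mem (edge_mem (.inr (.inr (.inl rfl))))
      (edge_mem (.inr (.inr (.inr rfl))))) (edge_mem (.inl rfl))) (edge_mem (.inr (.inl rfl)))
  · change boundary (Fin 4) 0 squareCycle = 0
    simp only [squareCycle, map_add, map_sub, boundary_edge]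
    abel

theorem isBarcode_square (h1 : 1 ≤ W) : IsBarcode (square W hW).persHomology {icoBar 0 W hW} :=
  WDgr.isBarcode_persHomology_singleton (Finsupp.lapply ![(0 : Fin 4), (2 : Fin 4)])
    (fun _ _ hc => square_mem_boundaries_iff h1 hc)
    fun _ ht => ⟨squareCycle, squareCycle_mem_cycles ht.1,
      squareCycle_zero_two.trans_ne one_ne_zero⟩

end Square

section DeletedSquare

variable {W t : ℝ} {hW : 0 < W}

lemma one_ne_fst_of_mem_square_deleteEdge {τ : Fin 4 × Fin 4}
    (h : τ ∈ ((square W hW).deleteEdge (squareEdge W hW)).E) : τ.1 ≠ 1 := by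
  obtain ⟨rfl | rfl | rfl | rfl, hne⟩ := h
  exacts [by decide, absurd rfl hne, by decide, by decide]

lemma one_three_notMem_square_deleteEdge_groundedEdges :
    ((1 : Fin 4), (3 : Fin 4)) ∉
      ((square W hW).deleteEdge (squareEdge W hW)).groundedEdges t := by
  rintro ⟨-, h | h⟩
  · exact one_ne_fst_of_mem_square_deleteEdge h rfl
  · obtain ⟨k, hk⟩ := WDgr.exists_edge_of_mem_filtEdges h
    exact one_ne_fst_of_mem_square_deleteEdge hk rfl

lemma add_one_le_of_zero_three_mem_square_deleteEdge_filtEdges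
    (h : ((0 : Fin 4), (3 : Fin 4)) ∈
      ((square W hW).deleteEdge (squareEdge W hW)).filtEdges t) : W + 1 ≤ t := by
  let π : Fin 4 → ℝ := ![0, 0, W, W + 1]
  have le_t : π 3 - π 0 ≤ t := by
    refine WDgr.sub_le_of_mem_filtEdges
      (G := (square W hW).deleteEdge (squareEdge W hW)) (π := π) ?_ h
    rintro ⟨τ, rfl | rfl | rfl | rfl, hne⟩
    · simp [π, square, WDgr.deleteEdge]
    · exact absurd rfl hne
    · simp [π, square, WDgr.deleteEdge]
    · simp [π, square, WDgr.deleteEdge]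
  simpa [π] using le_t

lemma zero_two_mem_square_deleteEdge_filtEdges (ht : W ≤ t) :
    ((0 : Fin 4), (2 : Fin 4)) ∈ ((square W hW).deleteEdge (squareEdge W hW)).filtEdges t := by
  have hE : ((0 : Fin 4), (2 : Fin 4)) ∈ (square W hW).E := .inr (.inr (.inl rfl))
  have ne_edge : ((0 : Fin 4), (2 : Fin 4)) ≠ (1, 3) := by decide
  exact WDgr.mem_filtEdges_of_edge ⟨hE, ne_edge⟩ ((square_w_zero_two hE).trans_le ht)

lemma two_three_mem_square_deleteEdge_filtEdges (ht : 1 ≤ t) :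
    ((2 : Fin 4), (3 : Fin 4)) ∈ ((square W hW).deleteEdge (squareEdge W hW)).filtEdges t := by
  have hE : ((2 : Fin 4), (3 : Fin 4)) ∈ (square W hW).E := .inr (.inr (.inr rfl))
  have ne_edge : ((2 : Fin 4), (3 : Fin 4)) ≠ (1, 3) := by decide
  have ne_zero_two : ((2 : Fin 4), (3 : Fin 4)) ≠ (0, 2) := by decide
  exact WDgr.mem_filtEdges_of_edge ⟨hE, ne_edge⟩ ((square_w_eq_one hE ne_zero_two).trans_le ht)

lemma square_deleteEdge_cycles_le_boundaries :
    ((square W hW).deleteEdge (squareEdge W hW)).cycles t ≤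
      ((square W hW).deleteEdge (squareEdge W hW)).boundaries t := by
  intro (c : Chains (Fin 4) 1) hc
  have poles_ne : (0 : Fin 4) ≠ 3 := by decide
  have hE : ((square W hW).deleteEdge (squareEdge W hW)).E ⊆
      suspensionEdges (0 : Fin 4) (3 : Fin 4) := fun τ hτ => square_E_subset_suspensionEdges hτ.1
  have hF := WDgr.groundedEdges_subset_suspensionEdges (t := t) poles_ne hE
  obtain ⟨hcE, hcycle⟩ := WDgr.mem_cycles_iff.1 hc
  obtain ⟨h13, h23, hsum⟩ := cycle_relations_of_subset_suspensionEdges hF hcE hcycle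
  refine (WDgr.mem_boundaries_iff_of_subset_suspensionEdges poles_ne hE hc).2 ?_
  have mem_grounded {u v : Fin 4} : c ![u, v] ≠ 0 →
      (u, v) ∈ ((square W hW).deleteEdge (squareEdge W hW)).groundedEdges t :=
    mem_allowedChains_one_iff.1 hcE u v
  have one_three : c ![1, 3] = 0 := by
    by_contra h
    exact one_three_notMem_square_deleteEdge_groundedEdges (mem_grounded h)
  have zero_one : c ![0, 1] = 0 := h13.trans one_three
  rw [zero_one, zero_add] at hsum
  have zero_three (hne : c ![0, 3] ≠ 0) : ((0 : Fin 4), (3 : Fin 4)) ∈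
      ((square W hW).deleteEdge (squareEdge W hW)).filtEdges t :=
    (mem_grounded hne).2.resolve_left
      fun h => zero_three_notMem_square_E h.1
  have add_one_le (hne : c ![0, 2] ≠ 0) : W + 1 ≤ t := by
    refine add_one_le_of_zero_three_mem_square_deleteEdge_filtEdges (zero_three fun h03 => hne ?_)
    rwa [h03, add_zero] at hsum
  exact mem_allowedChains_of_subset_suspensionEdges hF hcE (absurd zero_one) (absurd one_three)
    (fun h02 => zero_two_mem_square_deleteEdge_filtEdges (by linarith [add_one_le h02]))
    (fun hne => two_three_mem_square_deleteEdge_filtEdges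
      (by linarith [add_one_le (h23.trans_ne hne)])) zero_three

theorem isBarcode_square_deleteEdge :
    IsBarcode ((square W hW).deleteEdge (squareEdge W hW)).persHomology 0 :=
  isBarcode_zero fun _ => WDgr.subsingleton_homology square_deleteEdge_cycles_le_boundaries

theorem bottleneckDist_square (h1 : 1 ≤ W) :
    bottleneckDist (square W hW).barcode
      ((square W hW).deleteEdge (squareEdge W hW)).barcode = ENNReal.ofReal (W / 2) := by
  rw [WDgr.barcode, WDgr.barcode, (isBarcode_square h1).barcode_eq,
    isBarcode_square_deleteEdge.barcode_eq, bottleneckDist_icoBar_zero, sub_zero]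

end DeletedSquare

section NeighbourhoodGraph

lemma WDgr.inducedOnEdges_congr {V : Type} [Finite V] {E : Set (V × V)} {l : ∀ i, (i, i) ∉ E}
    {w w' : E → ℝ} {hw : ∀ e, 0 < w e} {hw' : ∀ e, 0 < w' e} {F : Set (V × V)} (hF : F ⊆ E)
    (h : ∀ τ (hτ : τ ∈ F), w ⟨τ, hF hτ⟩ = w' ⟨τ, hF hτ⟩) :
    (WDgr.mk V E l w hw).inducedOnEdges F hF = (WDgr.mk V E l w' hw').inducedOnEdges F hF := by
  simp only [WDgr.inducedOnEdges, WDgr.mk.injEq, heq_eq_eq, true_and]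
  funext τ
  exact h _ τ.2

lemma square_nbhdGraph_eq {W W' : ℝ} (hW : 0 < W) (hW' : 0 < W') :
    (square W hW).nbhdGraph {squareEdge W hW} = (square W' hW').nbhdGraph {squareEdge W' hW'} := by
  refine WDgr.inducedOnEdges_congr _ ?_
  rintro τ ⟨-, e, rfl, v, hv, hv'⟩
  have ne_zero_two : τ ≠ ((0 : Fin 4), (2 : Fin 4)) := by
    rintro rfl
    have disjoint_ends : ∀ v : Fin 4, v = 0 ∨ v = 2 → v = 1 ∨ v = 3 → False := by decide
    exact disjoint_ends v hv hv'
  exact (if_neg ne_zero_two).trans (if_neg ne_zero_two).symm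

theorem exists_nbhdGraph_eq_and_lt_bottleneckDist (r : ℝ) :
    ∃ (G : WDgr) (e : G.V × G.V), e ∈ G.E ∧
      G.nbhdGraph {e} = (square 1 one_pos).nbhdGraph {squareEdge 1 one_pos} ∧
      (r : EReal) < (bottleneckDist G.barcode (G.deleteEdge e).barcode : EReal) := by
  let W : ℝ := max 1 (2 * r + 1)
  have one_le : 1 ≤ W := le_max_left _ _
  have hW : 0 < W := one_pos.trans_le one_le
  refine ⟨square W hW, squareEdge W hW, squareEdge_mem W hW, square_nbhdGraph_eq hW one_pos, ?_⟩
  rw [bottleneckDist_square one_le, EReal.coe_ennreal_ofReal, max_eq_left (half_pos hW).le,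
    EReal.coe_lt_coe_iff]
  linarith [le_max_right 1 (2 * r + 1)]

end NeighbourhoodGraph

end GrPPH

end

theorem mainTheorem12 :
    (¬ ∃ f : GrPPH.WDgr → ℝ, ∀ (G : GrPPH.WDgr) (e : G.V × G.V), e ∈ G.E →
      (GrPPH.bottleneckDist G.barcode (G.deleteEdge e).barcode : EReal) ≤
        (f (G.nbhdGraph {e}) : EReal)) ∧
    ∃ N : GrPPH.WDgr, ∀ (W : ℝ) (hW : 0 < W), 1 ≤ W →
      GrPPH.squareEdge W hW ∈ (GrPPH.square W hW).E ∧
      (GrPPH.square W hW).nbhdGraph {GrPPH.squareEdge W hW} = N ∧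
      (∀ B : GrPPH.Barcode, GrPPH.IsBarcode (GrPPH.square W hW).persHomology B ↔
        B = {GrPPH.icoBar 0 W hW}) ∧
      (∀ B : GrPPH.Barcode,
        GrPPH.IsBarcode ((GrPPH.square W hW).deleteEdge (GrPPH.squareEdge W hW)).persHomology B ↔
          B = 0) ∧
      GrPPH.bottleneckDist (GrPPH.square W hW).barcode
        ((GrPPH.square W hW).deleteEdge (GrPPH.squareEdge W hW)).barcode =
          ENNReal.ofReal (W / 2) := by
  refine ⟨?_, (GrPPH.square 1 one_pos).nbhdGraph {GrPPH.squareEdge 1 one_pos}, fun W hW h1 =>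
    ⟨GrPPH.squareEdge_mem W hW, GrPPH.square_nbhdGraph_eq hW one_pos,
      fun _ => (GrPPH.isBarcode_square h1).isBarcode_iff,
      fun _ => GrPPH.isBarcode_square_deleteEdge.isBarcode_iff, GrPPH.bottleneckDist_square h1⟩⟩
  rintro ⟨f, hf⟩
  obtain ⟨G, e, he, hN, hlt⟩ := GrPPH.exists_nbhdGraph_eq_and_lt_bottleneckDist
    (f ((GrPPH.square 1 one_pos).nbhdGraph {GrPPH.squareEdge 1 one_pos}))
  exact hlt.not_ge (hN ▸ hf G e he)
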